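/- Theorem 1.1. Let $G$ be a Polish group, i.e. a topological group whose topology is separable and completely metrizable, and let $X$ be a standard Borel space, i.e. a set with a $\sigma$-algebra that is the Borel $\sigma$-algebra of some Polish topology. Let $G$ act on $X$ by a Borel action, i.e. an action for which the map $G\times X\to X$, $(g,x)\mapsto g\cdot x$, is Borel. Then: (i) there are a Polish space $Y$, an action of $G$ on $Y$ for which the map $G\times Y\to Y$, $(g,y)\mapsto g\cdot y$, is continuous, and a bijection $\pi: X\to Y$ such that $\pi$ and $\pi^{-1}$ are Borel and $\pi(g\cdot x)=g\cdot\pi(x)$ for all $g\in G$ and $x\in X$; (ii) (a reformulation of (i)) there is a Polish topology $\tau$ on $X$ whose Borel sets are exactly the given Borel sets of $X$, such that the action $G\times X\to X$ is continuous when $X$ carries $\tau$ and $G\times X$ the product topology. -/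

import Mathlib

universe u v

open Set Filter Topology TopologicalSpace MeasureTheory

/-! `exists_isVaughtBasis` refines the topology of `X`, keeping it Polish and its Borel sets
unchanged, until a countable basis of clopen sets has open Vaught transforms. The points generic in
their orbit then form a Gδ, hence Polish, set `C`, and comeagerly many translates of each point lie
in `C`. Give `X` the quotient topology of the action map `G × C → X`. This map is open since it
sends the trace of a box `W × A` to `A^{ΔW⁻¹}` (`image_mk_prod`), so the sets `A^{ΔW}` form a basis.
Category arguments make the quotient T₀ and regular, hence Polish by Sierpiński's theorem; left
multiplication on `G × C` makes the action continuous. The map is a Borel surjection from a Polish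
space, so the Borel sets do not change. -/

/-- A Gδ subset of a Polish space is Polish. -/
theorem IsGδ.polishSpace {α : Type*} [TopologicalSpace α] [PolishSpace α] {s : Set α}
    (hs : IsGδ s) : PolishSpace s := by
  obtain ⟨U, hU, rfl⟩ := hs.eq_iInter_nat
  have (n : ℕ) : PolishSpace (U n) := (hU n).polishSpace
  let f : (⋂ n, U n) → ∀ n, U n := fun x n => ⟨x, mem_iInter.1 x.2 n⟩
  have hf : Continuous f := by fun_prop
  have hind : IsInducing f :=
    .of_comp hf (continuous_subtype_val.comp (continuous_apply 0)) IsInducing.subtypeVal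
  have hinj : Function.Injective f := fun x y h =>
    Subtype.ext (congrArg (fun z : U 0 => (z : α)) (congrFun h 0))
  have hrange : range f = ⋂ n, {y : ∀ n, U n | (y n : α) = y 0} := by
    ext y
    simp only [mem_range, mem_iInter, mem_ofPred_eq]
    constructor
    · rintro ⟨x, rfl⟩ n
      rfl
    · intro h
      refine ⟨⟨y 0, mem_iInter.2 fun n => h n ▸ (y n).2⟩, ?_⟩
      funext n
      exact Subtype.ext (h n).symm
  have hcl : IsClosed (range f) := by
    rw [hrange]
    exact isClosed_iInter fun n => isClosed_eq (by fun_prop) (by fun_prop)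
  exact IsClosedEmbedding.polishSpace ⟨⟨hind, hinj⟩, hcl⟩

/-! ### Sierpiński's theorem on open images of Polish spaces -/

/-- The largest open set whose trace on the range of `i` is contained in `i '' u`. -/
def openExtension {Y Z : Type*} [TopologicalSpace Z] (i : Y → Z) (u : Set Y) : Set Z :=
  (closure (i '' uᶜ))ᶜ

section openExtension

variable {Y Z : Type*} [TopologicalSpace Z] {i : Y → Z} {u : Set Y}

theorem isOpen_openExtension : IsOpen (openExtension i u) := isClosed_closure.isOpen_compl

theorem mem_openExtension_iff [TopologicalSpace Y] (hi : IsInducing i) (hu : IsOpen u) {y : Y} :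
    i y ∈ openExtension i u ↔ y ∈ u := by
  rw [openExtension, mem_compl_iff, ← mem_preimage, ← hi.closure_eq_preimage_closure_image,
    hu.isClosed_compl.closure_eq, notMem_compl_iff]

theorem openExtension_subset_closure (hd : DenseRange i) :
    openExtension i u ⊆ closure (i '' u) := by
  intro z hz
  refine mem_closure_iff.2 fun o ho hzo => ?_
  obtain ⟨y, hy⟩ := hd.exists_mem_open (ho.inter isOpen_openExtension) ⟨z, hzo, hz⟩
  refine ⟨i y, hy.1, y, ?_, rfl⟩
  by_contra hyu
  exact hy.2 (subset_closure ⟨y, hyu, rfl⟩)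

end openExtension

/-- **Sierpiński's theorem**: a metrizable continuous open image of a Polish space is Polish. -/
theorem IsOpenQuotientMap.polishSpace_of_metrizable {P Y : Type*} [TopologicalSpace P]
    [PolishSpace P] [TopologicalSpace Y] [MetrizableSpace Y] {f : P → Y}
    (hf : IsOpenQuotientMap f) : PolishSpace Y := by
  let := metrizableSpaceMetric Y
  let := upgradeIsCompletelyMetrizable P
  have : SeparableSpace Y := hf.surjective.denseRange.separableSpace hf.continuous
  let i : Y → UniformSpace.Completion Y := (↑)
  have hi : IsEmbedding i := (UniformSpace.Completion.isUniformEmbedding_coe Y).isEmbedding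
  have hd : DenseRange i := UniformSpace.Completion.denseRange_coe
  have : SeparableSpace (UniformSpace.Completion Y) := inferInstance
  have : PolishSpace (UniformSpace.Completion Y) := inferInstance
  let B := countableBasis P
  let E : Set P → Set (UniformSpace.Completion Y) := fun u => openExtension i (f '' u)
  have hE {u : Set P} (hu : IsOpen u) {y : Y} : i y ∈ E u ↔ y ∈ f '' u :=
    mem_openExtension_iff hi.isInducing (hf.isOpenMap _ hu)
  let R : ℕ → Set P → Set (Set P) := fun n u =>
    {v | v ∈ B ∧ closure v ⊆ u ∧ ∀ x ∈ v, ∀ y ∈ v, dist x y ≤ (1 / 2 : ℝ) ^ n}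
  -- At a point of `T`, every `u` with `z ∈ E u` can be shrunk to arbitrarily small `v` with `z ∈ E
  -- v`; iterating, the sets close down on a preimage of `z`.
  let T : Set (UniformSpace.Completion Y) :=
    ⋂ n : ℕ, ⋂ u ∈ insert univ B, ((E u)ᶜ ∪ ⋃ v ∈ R n u, E v)
  have hB : B.Countable := countable_countableBasis P
  have hBo : ∀ u ∈ insert univ B, IsOpen u := by
    rintro u (rfl | hu)
    · exact isOpen_univ
    · exact isOpen_of_mem_countableBasis hu
  have hT : IsGδ T := by
    refine .iInter fun n => .biInter (hB.insert _) fun u _ => .union ?_ ?_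
    · exact isOpen_openExtension.isClosed_compl.isGδ
    · exact (isOpen_biUnion fun _ _ => isOpen_openExtension).isGδ
  have hTi : T = range i := by
    apply Subset.antisymm
    · intro z hz
      have step (n : ℕ) (u : {u // u ∈ insert univ B ∧ z ∈ E u}) :
          ∃ v : {u // u ∈ insert univ B ∧ z ∈ E u}, (v : Set P) ∈ R n u := by
        have h := mem_iInter₂.1 (mem_iInter.1 hz n) u.1 u.2.1
        rcases h with h | h
        · exact absurd u.2.2 h
        · obtain ⟨v, hv, hzv⟩ := mem_iUnion₂.1 h
          exact ⟨⟨v, mem_insert_of_mem _ hv.1, hzv⟩, hv⟩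
      choose F hF using step
      let U : ℕ → {u // u ∈ insert univ B ∧ z ∈ E u} := fun n =>
        Nat.rec ⟨univ, mem_insert _ _, by simp [E, openExtension, hf.surjective.range_eq]⟩ F n
      have hU (n : ℕ) : (U (n + 1)).1 ∈ R n (U n).1 := hF n (U n)
      have hanti : Antitone fun n : ℕ => (U n).1 :=
        antitone_nat_of_succ_le fun n => subset_closure.trans (hU n).2.1
      have hne (n : ℕ) : (U n).1.Nonempty := by
        have h : (i '' (f '' (U n).1)).Nonempty :=
          closure_nonempty_iff.1 ⟨z, openExtension_subset_closure hd (U n).2.2⟩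
        simpa using h
      choose p hp using hne
      -- The shift is needed because `U 0 = univ` has no diameter bound; `U (n + 1)` has diameter at
      -- most `(1 / 2) ^ n`.
      have hcau : CauchySeq fun n => p (n + 1) := by
        refine cauchySeq_of_le_geometric (1 / 2) 1 (by norm_num) fun n => ?_
        rw [one_mul]
        exact (hU n).2.2 _ (hp (n + 1)) _ (hanti (Nat.le_succ (n + 1)) (hp (n + 2)))
      obtain ⟨q, hq⟩ := cauchySeq_tendsto_of_complete hcau
      have hqU (n : ℕ) : q ∈ (U n).1 := by
        refine (hU n).2.1 (mem_closure_of_tendsto hq ?_)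
        filter_upwards [eventually_ge_atTop n] with m hm
        exact hanti (Nat.succ_le_succ hm) (hp (m + 1))
      refine ⟨f q, ?_⟩
      by_contra hne
      obtain ⟨O₁, O₂, hO₁, hO₂, h1, h2, hdisj⟩ := t2_separation hne
      have hcont : Continuous (i ∘ f) := hi.continuous.comp hf.continuous
      obtain ⟨ε, hε, hball⟩ := Metric.isOpen_iff.1 (hO₁.preimage hcont) q h1
      obtain ⟨n, hn⟩ := exists_pow_lt_of_lt_one hε (by norm_num : (1 / 2 : ℝ) < 1)
      obtain ⟨w, hw, hwz⟩ := mem_closure_iff.1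
        (openExtension_subset_closure hd (U (n + 1)).2.2) O₂ hO₂ h2
      obtain ⟨_, ⟨x, hx, rfl⟩, rfl⟩ := hwz
      have : x ∈ Metric.ball q ε := ((hU n).2.2 x hx q (hqU (n + 1))).trans_lt hn
      exact hdisj.le_bot ⟨hball this, hw⟩
    · rintro _ ⟨y, rfl⟩
      refine mem_iInter.2 fun n => mem_iInter₂.2 fun u hu => ?_
      by_cases hy : i y ∈ E u
      · refine Or.inr ?_
        obtain ⟨p, hpu, rfl⟩ := (hE (hBo u hu)).1 hy
        have hnhds : u ∩ Metric.ball p ((1 / 2) ^ n / 2) ∈ 𝓝 p :=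
          inter_mem ((hBo u hu).mem_nhds hpu) (Metric.ball_mem_nhds _ (by positivity))
        obtain ⟨c, hc, hcc, hcs⟩ := exists_mem_nhds_isClosed_subset hnhds
        obtain ⟨v, hvB, hpv, hvc⟩ := (isBasis_countableBasis P).mem_nhds_iff.1 hc
        have hcl : closure v ⊆ c := hcc.closure_subset_iff.2 hvc
        refine mem_iUnion₂.2 ⟨v, ⟨hvB, fun x hx => (hcs (hcl hx)).1, fun x hx y hy => ?_⟩,
          (hE (isOpen_of_mem_countableBasis hvB)).2 ⟨p, hpv, rfl⟩⟩
        have h1 := (hcs (hvc hx)).2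
        have h2 := (hcs (hvc hy)).2
        rw [Metric.mem_ball] at h1 h2
        linarith [dist_triangle_right x y p]
      · exact Or.inl hy
  have : PolishSpace (range i) := hTi ▸ hT.polishSpace
  exact hi.toHomeomorph.isClosedEmbedding.polishSpace

/-- A regular `T₀` continuous open image of a Polish space is Polish. -/
theorem IsOpenQuotientMap.polishSpace {P Y : Type*} [TopologicalSpace P]
    [PolishSpace P] [TopologicalSpace Y] [T0Space Y] [RegularSpace Y] {f : P → Y}
    (hf : IsOpenQuotientMap f) : PolishSpace Y := by
  have : SecondCountableTopology Y := by
    refine IsTopologicalBasis.secondCountableTopology (b := image f '' countableBasis P) ?_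
      ((countable_countableBasis P).image _)
    refine isTopologicalBasis_of_isOpen_of_nhds ?_ fun y o hy ho => ?_
    · rintro _ ⟨u, hu, rfl⟩
      exact hf.isOpenMap _ (isOpen_of_mem_countableBasis hu)
    · obtain ⟨p, rfl⟩ := hf.surjective y
      obtain ⟨u, hu, hpu, huo⟩ := (isBasis_countableBasis P).exists_subset_of_mem_open
        (show p ∈ f ⁻¹' o from hy) (ho.preimage hf.continuous)
      exact ⟨_, ⟨u, hu, rfl⟩, mem_image_of_mem f hpu, image_subset_iff.2 huo⟩
  exact hf.polishSpace_of_metrizable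

theorem IsMeagre.subset {X : Type*} [TopologicalSpace X] {s t : Set X} (hs : IsMeagre s)
    (hts : t ⊆ s) : IsMeagre t :=
  hs.mono hts

/-! ### Baire category quantifiers -/

section Category

variable {X G : Type*} [TopologicalSpace G]

theorem MeasurableSet.exists_isOpen_isMeagre_diff [MeasurableSpace G] [BorelSpace G] {s : Set G}
    (hs : MeasurableSet s) : ∃ o : Set G, IsOpen o ∧ IsMeagre (s \ o) ∧ IsMeagre (o \ s) := by
  obtain ⟨o, ho, h⟩ := hs.residualEq_isOpen
  refine ⟨o, ho, ?_, ?_⟩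
  · refine mem_of_superset (eventuallyEq_set.1 h) fun g (hg : g ∈ s ↔ g ∈ o) hgs => ?_
    exact hgs.2 (hg.1 hgs.1)
  · refine mem_of_superset (eventuallyEq_set.1 h) fun g (hg : g ∈ s ↔ g ∈ o) hgs => ?_
    exact hgs.2 (hg.2 hgs.1)

/-- By the Baire property `sᶜ` is open modulo meagre sets. The countable choice of `W` handles the
complement case when proving category quantifiers measurable. -/
theorem not_isMeagre_inter_compl_iff [MeasurableSpace G] [BorelSpace G] [BaireSpace G]
    [SecondCountableTopology G] {s V : Set G} (hs : MeasurableSet s) (hV : IsOpen V) :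
    ¬ IsMeagre {g | g ∈ V ∧ g ∉ s} ↔
      ∃ W ∈ countableBasis G, W ⊆ V ∧ IsMeagre {g | g ∈ W ∧ g ∈ s} := by
  constructor
  · intro h
    obtain ⟨o, ho, h1, h2⟩ := hs.compl.exists_isOpen_isMeagre_diff
    have hne : (V ∩ o).Nonempty := by
      by_contra hemp
      refine h (h1.subset fun g hg => ⟨hg.2, fun hgo => hemp ⟨g, hg.1, hgo⟩⟩)
    obtain ⟨g, hg⟩ := hne
    obtain ⟨W, hW, -, hWs⟩ := (isBasis_countableBasis G).exists_subset_of_mem_open hg (hV.inter ho)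
    exact ⟨W, hW, fun x hx => (hWs hx).1,
      h2.subset fun x hx => ⟨(hWs hx.1).2, fun hxs => hxs hx.2⟩⟩
  · rintro ⟨W, hW, hWV, hm⟩ h
    refine not_isMeagre_of_isOpen (isOpen_of_mem_countableBasis hW)
      (nonempty_of_mem_countableBasis hW) ((hm.union h).subset fun x hx => ?_)
    by_cases hxs : x ∈ s
    · exact Or.inl ⟨hx, hxs⟩
    · exact Or.inr ⟨hWV hx, hxs⟩

/-- The category quantifier `∃ g ∈ V`, read as "for nonmeagerly many", preserves measurability. -/
theorem MeasurableSet.setOf_not_isMeagre [MeasurableSpace X] [MeasurableSpace G] [BorelSpace G]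
    [BaireSpace G] [SecondCountableTopology G] {s : Set (X × G)} (hs : MeasurableSet s)
    {V : Set G} (hV : IsOpen V) :
    MeasurableSet {x | ¬ IsMeagre {g | g ∈ V ∧ (x, g) ∈ s}} := by
  induction s, hs using MeasurableSpace.induction_on_inter generateFrom_prod.symm
    isPiSystem_prod generalizing V with
  | empty => simp [IsMeagre.empty]
  | basic s hs =>
    obtain ⟨A, hA, U, -, rfl⟩ := hs
    by_cases h : IsMeagre {g | g ∈ V ∧ g ∈ U}
    · convert! MeasurableSet.empty
      refine eq_empty_of_forall_notMem fun x hx => hx (h.subset fun g hg => ⟨hg.1, hg.2.2⟩)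
    · convert! (show MeasurableSet A from hA) using 1
      ext x
      by_cases hx : x ∈ A
      · simpa only [mem_prod, hx, true_and, mem_ofPred_eq, iff_true] using h
      · simp [hx, IsMeagre.empty]
  | compl s hs ih =>
    have : {x | ¬ IsMeagre {g | g ∈ V ∧ (x, g) ∈ sᶜ}} =
        ⋃ W ∈ {W | W ∈ countableBasis G ∧ W ⊆ V},
          {x | ¬ IsMeagre {g | g ∈ W ∧ (x, g) ∈ s}}ᶜ := by
      ext x
      have := not_isMeagre_inter_compl_iff (hs.preimage measurable_prodMk_left : MeasurableSet
        (Prod.mk x ⁻¹' s)) hV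
      simp only [mem_preimage] at this
      simp [this, and_assoc]
    rw [this]
    exact .biUnion ((countable_countableBasis G).mono fun _ h => h.1) fun W hW =>
      (ih (isOpen_of_mem_countableBasis hW.1)).compl
  | iUnion f _ _ ih =>
    have : {x | ¬ IsMeagre {g | g ∈ V ∧ (x, g) ∈ ⋃ n, f n}} =
        ⋃ n, {x | ¬ IsMeagre {g | g ∈ V ∧ (x, g) ∈ f n}} := by
      ext x
      have : {g | g ∈ V ∧ (x, g) ∈ ⋃ n, f n} = ⋃ n, {g | g ∈ V ∧ (x, g) ∈ f n} := by
        ext g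
        simp
      rw [mem_ofPred_eq, this, mem_iUnion]
      constructor
      · intro h
        by_contra! hn
        exact h (isMeagre_iUnion fun n => not_not.1 (hn n))
      · rintro ⟨n, hn⟩ h
        exact hn (h.subset (subset_iUnion (fun n => {g | g ∈ V ∧ (x, g) ∈ f n}) n))
    rw [this]
    exact .iUnion fun n => ih n hV

end Category

/-! ### Refining Polish topologies -/

section Refinement

variable {X : Type*} [MeasurableSpace X]

theorem exists_polishSpace_le_forall_isOpen (t : TopologicalSpace X) (hp : PolishSpace X)
    (hb : BorelSpace X) {ι : Type*} [Countable ι] {s : ι → Set X} (hs : ∀ i, MeasurableSet (s i)) :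
    ∃ t' ≤ t, @PolishSpace X t' ∧ @BorelSpace X t' _ ∧ ∀ i, IsOpen[t'] (s i) := by
  choose m hm hmp _ ho using fun i => (hs i).isClopenable
  obtain ⟨t', h1, h2, h3⟩ := PolishSpace.exists_polishSpace_forall_le m hm hmp
  refine ⟨t', h2, h3, ⟨?_⟩, fun i => h1 i _ (ho i)⟩
  rw [borel_eq_borel_of_le h3 hp h2]
  exact hb.measurable_eq

/-- Given countably many operations on Borel sets, there is a Polish topology with the given Borel
sets and a countable basis all of whose members are sent to open sets by each operation. -/
theorem exists_polishSpace_basis_forall_isOpen [StandardBorelSpace X] {ι : Type*} [Countable ι]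
    {F : ι → Set X → Set X} (hF : ∀ i A, MeasurableSet A → MeasurableSet (F i A)) :
    ∃ t : TopologicalSpace X, @PolishSpace X t ∧ @BorelSpace X t _ ∧ ∃ B : Set (Set X),
      B.Countable ∧ @IsTopologicalBasis X t B ∧ ∀ A ∈ B, ∀ i, IsOpen[t] (F i A) := by
  let Q := {t : TopologicalSpace X // @PolishSpace X t ∧ @BorelSpace X t _}
  have step (q : Q) : ∃ q' : Q, q'.1 ≤ q.1 ∧ ∃ B : Set (Set X),
      B.Countable ∧ @IsTopologicalBasis X q.1 B ∧ ∀ A ∈ B, ∀ i, IsOpen[q'.1] (F i A) := by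
    obtain ⟨t, hp, hb⟩ := q
    obtain ⟨B, hc, -, hB⟩ := exists_countable_basis X
    have := hc.to_subtype
    obtain ⟨t', h1, h2, h3, h4⟩ := exists_polishSpace_le_forall_isOpen t hp hb
      (s := fun j : ι × B => F j.1 j.2)
      (fun j => hF _ _ (hB.isOpen j.2.2).measurableSet)
    exact ⟨⟨t', h2, h3⟩, h1, B, hc, hB,
      fun A hA i => h4 (i, ⟨A, hA⟩)⟩
  choose S hS B hB hbas hopen using step
  obtain ⟨t₀, hb₀, hp₀⟩ := StandardBorelSpace.polish (α := X)
  -- Each stage opens the `F`-images of a basis of the previous one. Along the chain the union of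
  -- these bases is a basis of the limit, so the limit is closed under the operations.
  let q : ℕ → Q := fun n => Nat.rec ⟨t₀, hp₀, hb₀⟩ (fun _ => S) n
  have hq (n : ℕ) : q (n + 1) = S (q n) := rfl
  have hanti : Antitone fun n => (q n).1 := antitone_nat_of_succ_le fun n => hS (q n)
  let t : TopologicalSpace X := ⨅ n, (q n).1
  have hle (n : ℕ) : t ≤ (q n).1 := iInf_le _ n
  have hp : @PolishSpace X t :=
    PolishSpace.iInf ⟨0, fun n => hanti (Nat.zero_le n)⟩ fun n => (q n).2.1
  refine ⟨t, hp, ⟨?_⟩, ⋃ n, B (q n), countable_iUnion fun n => hB _, ?_, ?_⟩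
  · rw [borel_eq_borel_of_le hp hp₀ (hle 0)]
    exact hb₀.measurable_eq
  · refine isTopologicalBasis_of_isOpen_of_nhds ?_ fun x o hx ho => ?_
    · intro A hA
      obtain ⟨n, hn⟩ := mem_iUnion.1 hA
      exact hle n _ (@IsTopologicalBasis.isOpen X (q n).1 _ _ (hbas (q n)) hn)
    · have h := ho.mem_nhds hx
      rw [nhds_iInf, mem_iInf_of_directed] at h
      · obtain ⟨n, hn⟩ := h
        obtain ⟨A, hA, hxA, hAo⟩ :=
          (@IsTopologicalBasis.mem_nhds_iff X (q n).1 _ _ _ (hbas (q n))).1 hn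
        exact ⟨A, mem_iUnion.2 ⟨n, hA⟩, hxA, hAo⟩
      · exact directed_of_isDirected_le fun m n hmn => nhds_mono (hanti hmn)
  · intro A hA i
    obtain ⟨n, hn⟩ := mem_iUnion.1 hA
    exact hle (n + 1) _ (hopen (q n) A hn i)

end Refinement

theorem measurableSet_setOf_smul_mem {G X : Type*} [MeasurableSpace G] [MeasurableSpace X]
    [SMul G X] (hact : Measurable fun p : G × X => p.1 • p.2) {A : Set X} (hA : MeasurableSet A)
    (x : X) :
    MeasurableSet {g : G | g • x ∈ A} :=
  hact.comp measurable_prodMk_right hA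

/-! ### Vaught transforms -/

section Vaught

variable {G X : Type*} [Group G] [TopologicalSpace G] [MulAction G X]

/-- The Vaught transform `A^{ΔV}`: the points `x` such that `g • x ∈ A` for nonmeagerly many
`g ∈ V`. -/
def vaughtDelta (A : Set X) (V : Set G) : Set X := {x | ¬ IsMeagre {g | g ∈ V ∧ g • x ∈ A}}

/-- The Vaught transform `A^{*V}`: the points `x` such that `g • x ∈ A` for comeagerly many
`g ∈ V`. -/
def vaughtStar (A : Set X) (V : Set G) : Set X := {x | IsMeagre {g | g ∈ V ∧ g • x ∉ A}}

theorem vaughtStar_eq_compl (A : Set X) (V : Set G) : vaughtStar A V = (vaughtDelta Aᶜ V)ᶜ := by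
  ext x
  simp [vaughtStar, vaughtDelta]

theorem vaughtStar_anti (A : Set X) {V W : Set G} (h : V ⊆ W) : vaughtStar A W ⊆ vaughtStar A V :=
  fun _ hx => IsMeagre.subset hx (fun _ hg => ⟨h hg.1, hg.2⟩)

theorem vaughtStar_mono {A A' : Set X} (h : A ⊆ A') (V : Set G) :
    vaughtStar A V ⊆ vaughtStar A' V :=
  fun _ hx => IsMeagre.subset hx (fun _ hg => ⟨hg.1, fun hA => hg.2 (h hA)⟩)

theorem vaughtDelta_mono {A A' : Set X} {V V' : Set G} (h : A ⊆ A') (h' : V ⊆ V') :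
    vaughtDelta A V ⊆ vaughtDelta A' V' :=
  fun _ hx hm => hx (hm.subset fun _ hg => ⟨h' hg.1, h hg.2⟩)

theorem isMeagre_setOf_mul_right_iff [IsTopologicalGroup G] {s : Set G} (h : G) :
    IsMeagre {g | g * h ∈ s} ↔ IsMeagre s := by
  have key (k : G) {s : Set G} (hs : IsMeagre s) : IsMeagre {g | g * k ∈ s} :=
    hs.preimage_of_isOpenMap (Homeomorph.mulRight k).continuous (Homeomorph.mulRight k).isOpenMap
  exact ⟨fun hs => by simpa using key h⁻¹ hs, key h⟩

/-- Right translation preserves meagreness; the set on the right is `V h`. -/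
theorem smul_mem_vaughtDelta_iff [IsTopologicalGroup G] {A : Set X} {V : Set G} {h : G} {x : X} :
    h • x ∈ vaughtDelta A V ↔ x ∈ vaughtDelta A {g | g * h⁻¹ ∈ V} := by
  rw [vaughtDelta, vaughtDelta, mem_ofPred_eq, mem_ofPred_eq, ← isMeagre_setOf_mul_right_iff h
    (s := {g | g ∈ {g | g * h⁻¹ ∈ V} ∧ g • x ∈ A})]
  simp [mul_smul]

theorem smul_mem_vaughtStar_iff [IsTopologicalGroup G] {A : Set X} {V : Set G} {h : G} {x : X} :
    h • x ∈ vaughtStar A V ↔ x ∈ vaughtStar A {g | g * h⁻¹ ∈ V} := by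
  simp only [vaughtStar_eq_compl, mem_compl_iff, smul_mem_vaughtDelta_iff]

theorem mem_vaughtDelta_of_mem_vaughtStar [BaireSpace G] {A : Set X} {V W : Set G} {x : X}
    (hV : IsOpen V) (hW : IsOpen W) (hne : (V ∩ W).Nonempty) (hx : x ∈ vaughtStar A V) :
    x ∈ vaughtDelta A W := by
  intro h
  refine not_isMeagre_of_isOpen (hV.inter hW) hne ((hx.union h).subset fun g hg => ?_)
  by_cases hA : g • x ∈ A
  · exact Or.inr ⟨hg.2, hA⟩
  · exact Or.inl ⟨hg.1, hA⟩

section Measurable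

variable [MeasurableSpace G] [BorelSpace G] [MeasurableSpace X]
  (hact : Measurable fun p : G × X => p.1 • p.2)
include hact

theorem measurableSet_vaughtDelta [BaireSpace G] [SecondCountableTopology G] {A : Set X}
    (hA : MeasurableSet A) {V : Set G} (hV : IsOpen V) : MeasurableSet (vaughtDelta A V) :=
  MeasurableSet.setOf_not_isMeagre (s := {p : X × G | p.2 • p.1 ∈ A})
    (hact.comp measurable_swap hA) hV

theorem measurableSet_vaughtStar [BaireSpace G] [SecondCountableTopology G] {A : Set X}
    (hA : MeasurableSet A) {V : Set G} (hV : IsOpen V) : MeasurableSet (vaughtStar A V) := by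
  rw [vaughtStar_eq_compl]
  exact (measurableSet_vaughtDelta hact hA.compl hV).compl

theorem exists_mem_vaughtStar_of_mem_vaughtDelta {A : Set X} (hA : MeasurableSet A) {V : Set G}
    (hV : IsOpen V) {x : X} (hx : x ∈ vaughtDelta A V) :
    ∃ W ⊆ V, IsOpen W ∧ W.Nonempty ∧ x ∈ vaughtStar A W := by
  obtain ⟨o, ho, h1, h2⟩ := (measurableSet_setOf_smul_mem hact hA x).exists_isOpen_isMeagre_diff
  refine ⟨V ∩ o, inter_subset_left, hV.inter ho, ?_, h2.subset fun g hg => ⟨hg.1.2, hg.2⟩⟩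
  by_contra hemp
  exact hx (h1.subset fun g hg => ⟨hg.2, fun hgo => hemp ⟨g, hg.1, hgo⟩⟩)

end Measurable

variable [SecondCountableTopology G]

variable (G) in
/-- A countable basis of closed sets whose Vaught transforms along basic open sets of `G` are
open. -/
structure IsVaughtBasis [TopologicalSpace X] (B : Set (Set X)) : Prop where
  countable : B.Countable
  isTopologicalBasis : IsTopologicalBasis B
  isClosed : ∀ A ∈ B, IsClosed A
  isOpen_vaughtDelta : ∀ A ∈ B, ∀ V ∈ countableBasis G, IsOpen (vaughtDelta A V)
  isOpen_vaughtStar : ∀ A ∈ B, ∀ V ∈ countableBasis G, IsOpen (vaughtStar A V)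

theorem exists_isVaughtBasis [BaireSpace G] [MeasurableSpace G] [BorelSpace G] [MeasurableSpace X]
    [StandardBorelSpace X] (hact : Measurable fun p : G × X => p.1 • p.2) :
    ∃ _ : TopologicalSpace X, PolishSpace X ∧ BorelSpace X ∧
      ∃ B : Set (Set X), IsVaughtBasis G B := by
  have := (countable_countableBasis G).to_subtype
  let F : Option (Bool × countableBasis G) → Set X → Set X
    | none, A => Aᶜ
    | some (true, V), A => vaughtDelta A (V : Set G)
    | some (false, V), A => vaughtStar A (V : Set G)
  obtain ⟨t, hp, hb, B, hBc, hB, hBo⟩ := exists_polishSpace_basis_forall_isOpen (F := F) (by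
    rintro (_ | ⟨_ | _, V⟩) A hA
    · exact hA.compl
    · exact measurableSet_vaughtStar hact hA (isOpen_of_mem_countableBasis V.2)
    · exact measurableSet_vaughtDelta hact hA (isOpen_of_mem_countableBasis V.2))
  exact ⟨t, hp, hb, B, hBc, hB, fun A hA => ⟨hBo A hA none⟩,
    fun A hA V hV => hBo A hA (some (true, ⟨V, hV⟩)),
    fun A hA V hV => hBo A hA (some (false, ⟨V, hV⟩))⟩

/-! ### Generic points of orbits -/

variable (G) in
/-- The points which are generic in their orbit: `x ∈ A` forces `g • x ∈ A` for comeagerly many `g`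
in a neighborhood of `1`, for all basic sets `A`. -/
def genericCore (B : Set (Set X)) : Set X :=
  {x | ∀ A ∈ B, x ∈ A → ∃ V ∈ countableBasis G, 1 ∈ V ∧ x ∈ vaughtStar A V}

section Core

variable [TopologicalSpace X] {B : Set (Set X)} (hB : IsVaughtBasis G B)
include hB

theorem IsVaughtBasis.isGδ_genericCore : IsGδ (genericCore G B) := by
  have : genericCore G B =
      ⋂ A ∈ B, (Aᶜ ∪ ⋃ V ∈ {V | V ∈ countableBasis G ∧ 1 ∈ V}, vaughtStar A V) := by
    ext x
    simp [genericCore, imp_iff_not_or, and_assoc]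
  rw [this]
  refine .biInter hB.countable fun A hA => (IsOpen.union ?_ ?_).isGδ
  · exact (hB.isClosed A hA).isOpen_compl
  · exact isOpen_biUnion fun V hV => hB.isOpen_vaughtStar A hA V hV.1

theorem IsVaughtBasis.exists_mem_vaughtStar {x : X} (hx : x ∈ genericCore G B) {A : Set X}
    (hA : IsOpen A) (hxA : x ∈ A) : ∃ V : Set G, IsOpen V ∧ 1 ∈ V ∧ x ∈ vaughtStar A V := by
  obtain ⟨A', hA', hxA', hs⟩ := hB.isTopologicalBasis.exists_subset_of_mem_open hxA hA
  obtain ⟨V, hV, h1, h⟩ := hx A' hA' hxA'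
  exact ⟨V, isOpen_of_mem_countableBasis hV, h1, vaughtStar_mono hs V h⟩

/-- For fixed `A`, the set of `g` with `g • x ∈ A` is an open `o` modulo meagre sets, and no `g ∈ o`
is bad: some `V g ⊆ o`. Countably many `A` suffice. -/
theorem IsVaughtBasis.isMeagre_setOf_smul_notMem_genericCore [IsTopologicalGroup G]
    [MeasurableSpace G] [BorelSpace G] [MeasurableSpace X] [BorelSpace X]
    (hact : Measurable fun p : G × X => p.1 • p.2) (x : X) :
    IsMeagre {g : G | g • x ∉ genericCore G B} := by
  have key (A : Set X) (hA : A ∈ B) : IsMeagre {g : G | g • x ∈ A ∧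
      ∀ V ∈ countableBasis G, 1 ∈ V → g • x ∉ vaughtStar A V} := by
    obtain ⟨o, ho, h1, h2⟩ := (measurableSet_setOf_smul_mem hact
      (hB.isTopologicalBasis.isOpen hA).measurableSet x).exists_isOpen_isMeagre_diff
    refine h1.subset fun g hg => ⟨hg.1, fun hgo => ?_⟩
    obtain ⟨V, hV, h1V, hVo⟩ := (isBasis_countableBasis G).exists_subset_of_mem_open
      (show (1 : G) ∈ {k | k * g ∈ o} by simpa using hgo)
      (ho.preimage (continuous_mul_const g))
    refine hg.2 V hV h1V (smul_mem_vaughtStar_iff.2 (h2.subset fun k hk => ⟨?_, hk.2⟩))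
    simpa using hVo hk.1
  refine (isMeagre_biUnion hB.countable key).subset fun g hg => ?_
  simp only [genericCore, mem_ofPred_eq, not_forall, not_exists, not_and] at hg
  obtain ⟨A, hA, hgA, h⟩ := hg
  exact mem_iUnion₂.2 ⟨A, hA, hgA, h⟩

/-- A nonmeagre set covered by countably many basic pieces has a nonmeagre piece, and the piece can
be chosen to work for all `h'` near `h`. -/
theorem IsVaughtBasis.isOpen_setOf_smul_mem_vaughtDelta [IsTopologicalGroup G]
    {A : Set X} (hA : IsOpen A) {W : Set G} (hW : IsOpen W) :
    IsOpen {p : G × X | p.1 • p.2 ∈ vaughtDelta A W} := by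
  refine isOpen_iff_mem_nhds.2 ?_
  rintro ⟨h, x⟩ hx
  have hx' : x ∈ vaughtDelta A {g | g * h⁻¹ ∈ W} := smul_mem_vaughtDelta_iff.1 hx
  let I : Set (Set G × Set X) := {q | q.1 ∈ countableBasis G ∧ q.2 ∈ B ∧ q.2 ⊆ A ∧
    ∃ N ∈ 𝓝 h, ∀ g ∈ q.1, ∀ h' ∈ N, g * h'⁻¹ ∈ W}
  have hI : I.Countable := Set.Countable.mono
    (fun q (hq : q ∈ I) => mk_mem_prod hq.1 hq.2.1) ((countable_countableBasis G).prod hB.countable)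
  obtain ⟨q, hq, hqx⟩ : ∃ q ∈ I, x ∈ vaughtDelta q.2 q.1 := by
    by_contra! hn
    have hm : IsMeagre (⋃ q ∈ I, {g | g ∈ q.1 ∧ g • x ∈ q.2}) :=
      isMeagre_biUnion hI fun q hq => not_not.1 (hn q hq)
    refine hx' (hm.subset ?_)
    rintro g ⟨hgW, hgA⟩
    obtain ⟨A', hA', hgA', hs⟩ := hB.isTopologicalBasis.exists_subset_of_mem_open hgA hA
    obtain ⟨u, v, hu, hv, hgu, hhv, huv⟩ := isOpen_prod_iff.1
      (hW.preimage (continuous_fst.mul continuous_snd.inv : Continuous fun p : G × G => p.1 * p.2⁻¹))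
      g h hgW
    obtain ⟨V, hV, hgV, hVu⟩ := (isBasis_countableBasis G).exists_subset_of_mem_open hgu hu
    exact mem_iUnion₂.2 ⟨(V, A'), ⟨hV, hA', hs, v, hv.mem_nhds hhv,
      fun g hg h' hh' => huv (mk_mem_prod (hVu hg) hh')⟩, hgV, hgA'⟩
  obtain ⟨hV, hqB, hqA, N, hN, hNW⟩ := hq
  filter_upwards [prod_mem_nhds hN ((hB.isOpen_vaughtDelta _ hqB _ hV).mem_nhds hqx)] with p hp
  exact smul_mem_vaughtDelta_iff.2
    (vaughtDelta_mono hqA (fun g hg => hNW g hg _ hp.1) hp.2)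

end Core

end Vaught

/-! ### The quotient topology of the action map -/

section Orbit

variable {G X : Type*} [Group G] [TopologicalSpace G] [MulAction G X]

/-- A copy of `X`, to be equipped with the quotient topology for the action map `G × C → X`. -/
@[nolint unusedArguments]
def SMulQuotient (_G : Type*) {X : Type*} (_C : Set X) : Type _ := X

namespace SMulQuotient

variable {C : Set X}

instance : MulAction G (SMulQuotient G C) := inferInstanceAs (MulAction G X)

variable (G C) in
/-- The restriction of the action map to `G × C`. -/
def mk (p : G × C) : SMulQuotient G C := (p.1 • (p.2 : X) : X)

instance [TopologicalSpace X] : TopologicalSpace (SMulQuotient G C) :=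
  .coinduced (mk G C) inferInstance

/-- Openness makes the product with the identity of `G` a quotient map, so continuity can be tested
on `G × (G × C)`. -/
theorem continuousSMul [ContinuousMul G] [TopologicalSpace X] (h : IsOpenQuotientMap (mk G C)) :
    ContinuousSMul G (SMulQuotient G C) := by
  refine ⟨((IsOpenQuotientMap.id (X := G)).prodMap h).isQuotientMap.continuous_iff.2 ?_⟩
  have : (fun p : G × SMulQuotient G C => p.1 • p.2) ∘ Prod.map id (mk G C) =
      mk G C ∘ fun q : G × (G × C) => (q.1 * q.2.1, q.2.2) := by
    funext q
    exact (mul_smul q.1 q.2.1 (q.2.2 : X)).symm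
  rw [this]
  exact h.continuous.comp (by fun_prop)

end SMulQuotient

namespace IsVaughtBasis

variable [IsTopologicalGroup G] [SecondCountableTopology G] [TopologicalSpace X] {B : Set (Set X)}
  (hB : IsVaughtBasis G B)
include hB

theorem isOpen_smulQuotient_vaughtDelta {A : Set X} (hA : IsOpen A) {W : Set G} (hW : IsOpen W)
    (C : Set X) : IsOpen (X := SMulQuotient G C) (vaughtDelta A W) :=
  isOpen_coinduced.2 <| (hB.isOpen_setOf_smul_mem_vaughtDelta hA hW).preimage
    (continuous_id.prodMap continuous_subtype_val)

variable [BaireSpace G] [MeasurableSpace G] [BorelSpace G] [MeasurableSpace X] [BorelSpace X]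
  (hact : Measurable fun p : G × X => p.1 • p.2)
include hact

theorem image_mk_prod {A : Set X} (hA : IsOpen A) {W : Set G} (hW : IsOpen W) :
    SMulQuotient.mk G (genericCore G B) '' (W ×ˢ ((↑) ⁻¹' A)) = vaughtDelta A W⁻¹ := by
  ext y
  constructor
  · rintro ⟨⟨g, z⟩, ⟨hg, hz⟩, rfl⟩
    obtain ⟨V, hV, h1, hzV⟩ := hB.exists_mem_vaughtStar z.2 hA hz
    refine smul_mem_vaughtDelta_iff.2 (mem_vaughtDelta_of_mem_vaughtStar hV
      (hW.inv.preimage (continuous_mul_const g⁻¹)) ⟨1, h1, ?_⟩ hzV)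
    simpa using hg
  · intro hy
    have hne : {g | g ∈ W⁻¹ ∧ g • y ∈ A ∧ g • y ∈ genericCore G B}.Nonempty := by
      by_contra hemp
      refine hy ((hB.isMeagre_setOf_smul_notMem_genericCore hact y).subset fun g hg hC => ?_)
      exact hemp ⟨g, hg.1, hg.2, hC⟩
    obtain ⟨g, hg, hgA, hgC⟩ := hne
    exact ⟨(g⁻¹, ⟨g • y, hgC⟩), ⟨hg, hgA⟩, inv_smul_smul g y⟩

theorem isOpenQuotientMap_mk :
    IsOpenQuotientMap (SMulQuotient.mk G (genericCore G B)) := by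
  refine ⟨?_, continuous_coinduced_rng, fun U hU => ?_⟩
  · intro y
    have h : y ∈ vaughtDelta univ (univ : Set G)⁻¹ := by
      simpa [vaughtDelta] using not_isMeagre_of_isOpen (isOpen_univ (X := G)) univ_nonempty
    obtain ⟨p, -, hp⟩ := (hB.image_mk_prod hact isOpen_univ isOpen_univ).ge h
    exact ⟨p, hp⟩
  · refine isOpen_iff_forall_mem_open.2 ?_
    rintro _ ⟨⟨g, z⟩, hgz, rfl⟩
    obtain ⟨W, O, hW, hO, hg, hz, hsub⟩ := isOpen_prod_iff.1 hU g z hgz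
    obtain ⟨A, hA, rfl⟩ := isOpen_induced_iff.1 hO
    refine ⟨vaughtDelta A W⁻¹, ?_, hB.isOpen_smulQuotient_vaughtDelta hA hW.inv _, ?_⟩
    · exact (hB.image_mk_prod hact hA hW).ge.trans (image_mono hsub)
    · exact (hB.image_mk_prod hact hA hW).le ⟨(g, z), ⟨hg, hz⟩, rfl⟩

theorem exists_vaughtDelta_subset {o : Set (SMulQuotient G (genericCore G B))} (ho : IsOpen o)
    {x : X} (hx : x ∈ o) : ∃ A ∈ B, ∃ W : Set G, IsOpen W ∧ x ∈ vaughtDelta A W ∧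
      vaughtDelta A W ⊆ o := by
  obtain ⟨⟨g, z⟩, rfl⟩ := (hB.isOpenQuotientMap_mk hact).surjective x
  obtain ⟨W, O, hW, hO, hg, hz, hsub⟩ := isOpen_prod_iff.1 (isOpen_coinduced.1 ho) g z hx
  obtain ⟨A, hA, rfl⟩ := isOpen_induced_iff.1 hO
  obtain ⟨A', hA', hzA', hs⟩ := hB.isTopologicalBasis.exists_subset_of_mem_open hz hA
  have himage := hB.image_mk_prod hact (hB.isTopologicalBasis.isOpen hA') hW
  refine ⟨A', hA', W⁻¹, hW.inv, himage.le ⟨(g, z), ⟨hg, hzA'⟩, rfl⟩, himage.ge.trans ?_⟩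
  exact image_subset_iff.2 fun p hp => hsub ⟨hp.1, hs hp.2⟩

theorem regularSpace_smulQuotient :
    RegularSpace (SMulQuotient G (genericCore G B)) := by
  refine .of_exists_mem_nhds_isClosed_subset fun (x : X) s hs => ?_
  obtain ⟨o, hos, ho, hxo⟩ := mem_nhds_iff.1 hs
  obtain ⟨A, hA, U, hU, hxU, hUo⟩ := hB.exists_vaughtDelta_subset hact ho hxo
  have hAm : MeasurableSet A := (hB.isTopologicalBasis.isOpen hA).measurableSet
  obtain ⟨U', hU'U, hU', ⟨g₀, hg₀⟩, hxU'⟩ :=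
    exists_mem_vaughtStar_of_mem_vaughtDelta hact hAm hU hxU
  -- With `U'' v ⊆ U'` and `u₂ v₂⁻¹ ⊆ U''`, the open set `(A^{*U''})^{Δ(v ∩ v₂)}` contains `x` and
  -- lies in the closed set `A^{*(u₂ ∩ U')} ⊆ A^{ΔU}`.
  obtain ⟨u, v, hu, hv, hgu, h1v, huv⟩ := isOpen_prod_iff.1 (hU'.preimage continuous_mul) g₀ 1
    (by simpa using hg₀)
  obtain ⟨U'', hU'', hgU'', hU''u⟩ := (isBasis_countableBasis G).exists_subset_of_mem_open hgu hu
  have hU''o : IsOpen U'' := isOpen_of_mem_countableBasis hU''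
  obtain ⟨u₂, v₂, hu₂, hv₂, hgu₂, h1v₂, huv₂⟩ := isOpen_prod_iff.1
    (hU''o.preimage (continuous_fst.mul continuous_snd.inv :
      Continuous fun p : G × G => p.1 * p.2⁻¹)) g₀ 1 (by simpa using hgU'')
  have hsmul (g : G) (hg : g ∈ v) : g • x ∈ vaughtStar A U'' := by
    refine smul_mem_vaughtStar_iff.2 (vaughtStar_anti A (fun k hk => ?_) hxU')
    have : (k * g⁻¹, g) ∈ u ×ˢ v := ⟨hU''u hk, hg⟩
    simpa using huv this
  have hBo : IsOpen (vaughtStar A U'') := hB.isOpen_vaughtStar A hA U'' hU''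
  refine ⟨vaughtStar A (u₂ ∩ U'), mem_nhds_iff.2
    ⟨vaughtDelta (vaughtStar A U'') (v ∩ v₂), ?_,
      hB.isOpen_smulQuotient_vaughtDelta hBo (hv.inter hv₂) _, ?_⟩, ?_, ?_⟩
  · intro y hy
    obtain ⟨g, hg, hgy⟩ := nonempty_of_not_isMeagre hy
    refine vaughtStar_anti A (fun k hk => ?_) (smul_mem_vaughtStar_iff.1 hgy)
    exact huv₂ (mk_mem_prod hk.1 hg.2)
  · intro h
    exact not_isMeagre_of_isOpen (hv.inter hv₂) ⟨1, h1v, h1v₂⟩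
      (h.subset fun g hg => ⟨hg, hsmul g hg.1⟩)
  · have := (hB.isOpen_smulQuotient_vaughtDelta (hB.isClosed A hA).isOpen_compl
      (hu₂.inter hU') (genericCore G B)).isClosed_compl
    exact (vaughtStar_eq_compl A (u₂ ∩ U')) ▸ this
  · refine Subset.trans (fun y hy => ?_) (hUo.trans hos)
    exact mem_vaughtDelta_of_mem_vaughtStar (hu₂.inter hU') hU ⟨g₀, ⟨hgu₂, hg₀⟩, hU'U hg₀⟩ hy

/-- Translate both points into the core by one `g`. A clopen `A` separating the translates gives a
transform containing only one of them. -/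
theorem t0Space_smulQuotient [T2Space X] :
    T0Space (SMulQuotient G (genericCore G B)) := by
  refine (t0Space_iff_inseparable _).2 fun (x y : X) hxy => ?_
  have hiff {A : Set X} (hA : IsOpen A) {W : Set G} (hW : IsOpen W) :
      x ∈ vaughtDelta A W ↔ y ∈ vaughtDelta A W :=
    inseparable_iff_forall_isOpen.1 hxy _
      (hB.isOpen_smulQuotient_vaughtDelta hA hW _)
  obtain ⟨g, hg⟩ : ∃ g : G, g • x ∈ genericCore G B ∧ g • y ∈ genericCore G B := by
    by_contra! hn
    refine not_isMeagre_of_isOpen (isOpen_univ (X := G)) univ_nonempty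
      (((hB.isMeagre_setOf_smul_notMem_genericCore hact x).union
        (hB.isMeagre_setOf_smul_notMem_genericCore hact y)).subset fun g _ => ?_)
    by_cases h : g • x ∈ genericCore G B
    · exact Or.inr (hn g h)
    · exact Or.inl h
  refine MulAction.injective g (show g • x = g • y from ?_)
  by_contra hne
  obtain ⟨O, O', hO, -, hxO, hyO, hdisj⟩ := t2_separation hne
  obtain ⟨A, hA, hxA, hAO⟩ := hB.isTopologicalBasis.exists_subset_of_mem_open hxO hO
  have hyA : g • y ∈ Aᶜ := fun h => hdisj.le_bot ⟨hAO h, hyO⟩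
  have hAo := hB.isTopologicalBasis.isOpen hA
  obtain ⟨V, hV, h1V, hxV⟩ := hB.exists_mem_vaughtStar hg.1 hAo hxA
  obtain ⟨V', hV', h1V', hyV'⟩ :=
    hB.exists_mem_vaughtStar hg.2 (hB.isClosed A hA).isOpen_compl hyA
  have h1 : g • x ∈ vaughtDelta A V' :=
    mem_vaughtDelta_of_mem_vaughtStar hV hV' ⟨1, h1V, h1V'⟩ hxV
  have h2 : g • y ∈ vaughtDelta A V' := smul_mem_vaughtDelta_iff.2
    ((hiff hAo (hV'.preimage (continuous_mul_const g⁻¹))).1 (smul_mem_vaughtDelta_iff.1 h1))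
  exact h2 (by simpa [vaughtStar] using hyV')

end IsVaughtBasis

end Orbit

/-! ### The Becker–Kechris theorem -/

/-- A Borel action of a Polish group on a standard Borel space is continuous for some Polish
topology with the given Borel sets. -/
theorem exists_polishSpace_continuousSMul {G X : Type*} [Group G] [TopologicalSpace G]
    [IsTopologicalGroup G] [PolishSpace G] [MeasurableSpace G] [BorelSpace G] [MeasurableSpace X]
    [StandardBorelSpace X] [MulAction G X] (hact : Measurable fun p : G × X => p.1 • p.2) :
    ∃ τ : TopologicalSpace X, @PolishSpace X τ ∧ @BorelSpace X τ _ ∧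
      @ContinuousSMul G X _ _ τ := by
  have : BaireSpace G := by
    let := upgradeIsCompletelyMetrizable G
    infer_instance
  obtain ⟨t, ht, hb, B, hB⟩ := exists_isVaughtBasis hact
  have : PolishSpace (genericCore G B) := hB.isGδ_genericCore.polishSpace
  have hq := hB.isOpenQuotientMap_mk hact
  let π : G × genericCore G B → X := SMulQuotient.mk G (genericCore G B)
  have hmeas : Measurable π :=
    hact.comp (measurable_fst.prodMk (measurable_subtype_coe.comp measurable_snd))
  let Y := SMulQuotient G (genericCore G B)
  let : MeasurableSpace Y := ‹MeasurableSpace X›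
  have : T0Space Y := hB.t0Space_smulQuotient hact
  have : RegularSpace Y := hB.regularSpace_smulQuotient hact
  have hp : PolishSpace Y := hq.polishSpace
  have : OpensMeasurableSpace Y := by
    refine ⟨MeasurableSpace.generateFrom_le fun s hs => ?_⟩
    have ho : IsOpen (π ⁻¹' s) := isOpen_coinduced.1 hs
    -- Lusin separation: a set with Borel preimage under this Borel surjection is Borel.
    exact (hmeas.measurableSet_preimage_iff_of_surjective hq.surjective).1 ho.measurableSet
  have hb : BorelSpace Y := Measurable.borelSpace_codomain (Y := Y) hmeas hq.surjective
  have hc : ContinuousSMul G Y := SMulQuotient.continuousSMul hq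
  exact ⟨(inferInstance : TopologicalSpace Y), hp, hb, hc⟩

/-- Every Borel action of a Polish group `G` on a standard Borel space `X` is equivariantly Borel
isomorphic to a (jointly) continuous action of `G` on a Polish space; and `X` itself carries a
Polish topology with the given Borel sets that makes the action (jointly) continuous. -/
theorem theorem1p1 {G : Type u} [Group G] [TopologicalSpace G] [IsTopologicalGroup G]
    [PolishSpace G] [MeasurableSpace G] [BorelSpace G]
    {X : Type v} [MeasurableSpace X] [StandardBorelSpace X] [MulAction G X]
    (hact : Measurable (fun p : G × X => p.1 • p.2)) :
    (∃ (Y : Type v) (_ : TopologicalSpace Y) (_ : PolishSpace Y)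
        (_ : MeasurableSpace Y) (_ : BorelSpace Y)
        (_ : MulAction G Y) (_ : ContinuousSMul G Y) (π : X ≃ᵐ Y),
        ∀ (g : G) (x : X), π (g • x) = g • π x) ∧
    (∃ τ : TopologicalSpace X,
        @PolishSpace X τ ∧ @BorelSpace X τ _ ∧
          @ContinuousSMul G X _ _ τ) := by
  obtain ⟨τ, hp, hb, hc⟩ := exists_polishSpace_continuousSMul hact
  exact ⟨⟨X, τ, hp, _, hb, _, hc, .refl X, fun _ _ => rfl⟩, τ, hp, hb, hc⟩
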